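/- Let $d_1,d_2,d_3$ be positive integers and $r\ge 0$ an integer with $d_1+d_2+d_3=r+3$. Let $x_1,x_2,x_3$ and $a_j,b_j,c_j$ ($1\le j\le r$) be indeterminates over $\mathbb{Z}$, and let $F$ be the polynomial in them, cubic in $x_1,x_2,x_3$, given by the coefficient of $H_1^{d_1}H_2^{d_2}H_3^{d_3}$ in $$(x_1H_1+x_2H_2+x_3H_3)^3\prod_{j=1}^r(a_jH_1+b_jH_2+c_jH_3).$$ Let $B=(B_{pq})_{1\le p,q\le 3}$ be the matrix of signed cofactors of the Hessian matrix $\left(\partial^2F/\partial x_p\partial x_q\right)_{1\le p,q\le 3}$. Its entries are polynomials with integer coefficients in the $a_j,b_j,c_j$ and $x_1,x_2,x_3$. For every $p$, each non-zero coefficient of the polynomial $B_{pp}$ is negative; and for all $p\neq q$, each non-zero coefficient of the polynomial $B_{pq}$ is positive. -/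

import Mathlib

open MvPolynomial

noncomputable section

namespace CubicCofactors

/-- The index set of the indeterminates. `Sum.inl i` stands for the variable `x_i`, and
`Sum.inr (i, j)` for the coefficient of `H_i` in the `j`-th linear factor: with `i` running
through `0, 1, 2`, these are `a_j`, `b_j`, `c_j` respectively. -/
abbrev Var (r : ℕ) : Type := Fin 3 ⊕ (Fin 3 × Fin r)

/-- The ring of polynomials with integer coefficients in `x_1, x_2, x_3` and
all the `a_j, b_j, c_j`. -/
abbrev CoeffRing (r : ℕ) : Type := MvPolynomial (Var r) ℤ

/-- The formal product `(x_1 H_1 + x_2 H_2 + x_3 H_3)^3 ∏_j (a_j H_1 + b_j H_2 + c_j H_3)`,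
a polynomial in `H_1, H_2, H_3` over `CoeffRing r`. -/
def formalProduct (r : ℕ) : MvPolynomial (Fin 3) (CoeffRing r) :=
  (∑ i : Fin 3, C (X (Sum.inl i)) * X i) ^ 3 *
    ∏ j : Fin r, ∑ i : Fin 3, C (X (Sum.inr (i, j))) * X i

/-- The cubic `F`: the coefficient of `H_1 ^ d_1 H_2 ^ d_2 H_3 ^ d_3` in the formal product. -/
def cubic (r : ℕ) (d : Fin 3 → ℕ) : CoeffRing r :=
  coeff (Finsupp.equivFunOnFinite.symm d) (formalProduct r)

/-- The Hessian matrix of `F`: its second partial derivatives with respect to the `x_i`. -/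
def hessian (r : ℕ) (d : Fin 3 → ℕ) : Matrix (Fin 3) (Fin 3) (CoeffRing r) :=
  Matrix.of fun p q => pderiv (Sum.inl p) (pderiv (Sum.inl q) (cubic r d))

/-- The matrix `B` of (signed) cofactors of the Hessian matrix. As the Hessian matrix is
symmetric, its cofactor matrix and its adjugate agree. -/
def cofactors (r : ℕ) (d : Fin 3 → ℕ) : Matrix (Fin 3) (Fin 3) (CoeffRing r) :=
  (hessian r d).adjugate

end CubicCofactors

end

/-!
Write `e_i` for the unit vectors of `ℤ³`. Differentiating `(x · H) ^ 3` twice shows that the entry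
`(p, q)` of the Hessian matrix is `6 P(d - e_p - e_q)`, where `P(m)` is the coefficient of `H ^ m`
in the product of the linear form `x · H` with the remaining `r` linear forms
(`hessian_apply`). So each cofactor is, up to the factor `36`, a difference
`P(m) P(m') - P(n) P(n')` with `m + m' = n + n'`.

To compare two such products, introduce a second set of variables `K` and look at the factors
of `P(H) P(K)`: a linear form `y` contributes
`∑ y_i² H_i K_i + ∑_{i < j} y_i y_j (H_i K_j + H_j K_i)`.
Expanding the product, `P(m) P(m')` becomes a sum, with coefficients that are monomials in the
indeterminates, of numbers counting the orientations of a multigraph on three vertices with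
prescribed out-degrees. The terms `H_i K_i` are loops and only translate `m + m'`. The `k` parallel
edges between two vertices can be oriented so that their net flow is `x` in as many ways as the
coefficient of `T ^ x` in `(T + T⁻¹) ^ k`. This coefficient is even in `x` and, along each residue
class modulo `2`, decreases away from the origin. Hence `(m, m') ↦ P(m) P(m')` lies in
the cone `flowCone` spanned by the flow numbers `flow u v w` of a triangle whose edges are weighted
by such functions `u, v, w` (`prod_linForm_mem_flowCone`).

It remains to compare flow numbers at two net inflows. Pairing `x` with `-x` in the defining sum
shows that the difference of the two flow numbers is half the sum of terms
`(u (x - 1) - u (x + 1)) * (v (x - 1) - v (x + 1))` weighted by nonnegative numbers, and both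
factors have the sign of `x` (`IsSymmUnimodal.diff_mul_diff_nonneg`). This gives one inequality for
each of the six entries on or above the diagonal.
-/

open MvPolynomial

namespace CubicCofactors

/-! ### Symmetric unimodal functions on the integers -/

/-- A finitely supported function `u : ℤ → ℤ` with `u ≥ 0` that is even and decreases away from the
origin along each of the two residue classes modulo `2`. The model case is the function sending
`x` to the coefficient of `T ^ x` in `(T + T⁻¹) ^ k`, which vanishes on one of the classes. -/
structure IsSymmUnimodal (u : ℤ → ℤ) : Prop where
  finite_support : u.support.Finite
  nonneg : ∀ x, 0 ≤ u x
  even : ∀ x, u (-x) = u x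
  anti : ∀ x, -1 ≤ x → u (x + 2) ≤ u x

namespace IsSymmUnimodal

variable {u v w : ℤ → ℤ}

lemma indicator_zero : IsSymmUnimodal (fun x => if x = 0 then 1 else 0) where
  finite_support := (Set.finite_singleton (0 : ℤ)).subset fun x hx => by
    by_contra h
    simp_all
  nonneg x := by split_ifs <;> simp
  even x := by simp
  anti x hx := by
    rw [if_neg (by omega)]
    split_ifs <;> simp

lemma mul (hu : IsSymmUnimodal u) (hv : IsSymmUnimodal v) :
    IsSymmUnimodal (fun x => u x * v x) where
  finite_support := hu.finite_support.subset fun x hx h => hx (by simp [h])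
  nonneg x := mul_nonneg (hu.nonneg x) (hv.nonneg x)
  even x := by rw [hu.even, hv.even]
  anti x hx := mul_le_mul (hu.anti x hx) (hv.anti x hx) (hv.nonneg _) (hu.nonneg _)

lemma finite_support_comp (hu : IsSymmUnimodal u) (e : ℤ ≃ ℤ) :
    (fun x => u (e x)).support.Finite :=
  hu.finite_support.preimage e.injective.injOn

/-- Multiplication by `T + T⁻¹` preserves symmetric unimodality. -/
lemma step (hu : IsSymmUnimodal u) : IsSymmUnimodal (fun x => u (x - 1) + u (x + 1)) where
  finite_support := ((hu.finite_support_comp (Equiv.subRight 1)).union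
    (hu.finite_support_comp (Equiv.addRight 1))).subset (Function.support_add _ _)
  nonneg x := add_nonneg (hu.nonneg _) (hu.nonneg _)
  even x := by
    rw [← hu.even (-x - 1), ← hu.even (-x + 1), add_comm]
    ring_nf
  anti x hx := by
    rcases hx.eq_or_lt with rfl | hx
    -- At `x = -1` both sides equal `u 0 + u 2`.
    · have := hu.even 2
      norm_num at this ⊢
      omega
    · have h1 := hu.anti (x - 1) (by omega)
      have h2 := hu.anti (x + 1) (by omega)
      rw [show x - 1 + 2 = x + 1 by ring] at h1
      rw [show x + 2 - 1 = x + 1 by ring]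
      rw [show x + 1 + 2 = x + 2 + 1 by ring] at h2
      omega

/-- The differences of two symmetric unimodal functions across the same gap of length `2` have
the same sign, namely that of the midpoint. -/
lemma diff_mul_diff_nonneg (hu : IsSymmUnimodal u) (hv : IsSymmUnimodal v) (x : ℤ) :
    0 ≤ (u (x - 1) - u (x + 1)) * (v (x - 1) - v (x + 1)) := by
  have key : ∀ {f : ℤ → ℤ}, IsSymmUnimodal f → ∀ y, 0 ≤ y → f (y + 1) ≤ f (y - 1) := by
    intro f hf y hy
    have := hf.anti (y - 1) (by omega)
    rwa [show y - 1 + 2 = y + 1 by ring] at this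
  have refl : ∀ {f : ℤ → ℤ}, IsSymmUnimodal f → ∀ y, y ≤ 0 → f (y - 1) ≤ f (y + 1) := by
    intro f hf y hy
    have := key hf (-y) (by omega)
    rwa [← hf.even (-y + 1), ← hf.even (-y - 1), show -(-y + 1) = y - 1 by ring,
      show -(-y - 1) = y + 1 by ring] at this
  rcases le_total 0 x with hx | hx
  · exact mul_nonneg (sub_nonneg.2 (key hu x hx)) (sub_nonneg.2 (key hv x hx))
  · exact mul_nonneg_of_nonpos_of_nonpos (sub_nonpos.2 (refl hu x hx))
      (sub_nonpos.2 (refl hv x hx))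

/-- Twice the difference of the two sides is the sum of
`u x * ((v (x - 1) - v (x + 1)) * (w (x - 1) - w (x + 1)))`. -/
lemma finsum_mul_shift_le (hu : IsSymmUnimodal u) (hv : IsSymmUnimodal v)
    (hw : IsSymmUnimodal w) :
    ∑ᶠ x, u x * (v (x - 1) * w (x + 1)) ≤ ∑ᶠ x, u x * (v (x - 1) * w (x - 1)) := by
  have fin : ∀ g : ℤ → ℤ, (fun x => u x * g x).support.Finite := fun g =>
    hu.finite_support.subset fun x hx h => hx (by simp [h])
  have hneg : ∀ g : ℤ → ℤ, ∑ᶠ x, u x * g x = ∑ᶠ x, u x * g (-x) := fun g => by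
    rw [← finsum_comp_equiv (Equiv.neg ℤ)]
    exact finsum_congr fun x => by simp [hu.even]
  have e1 := hneg fun x => v (x - 1) * w (x - 1)
  have e2 := hneg fun x => v (x - 1) * w (x + 1)
  have refl_sub : ∀ {f : ℤ → ℤ}, IsSymmUnimodal f → ∀ x, f (-x - 1) = f (x + 1) :=
    fun hf x => by rw [← hf.even]; ring_nf
  have refl_add : ∀ {f : ℤ → ℤ}, IsSymmUnimodal f → ∀ x, f (-x + 1) = f (x - 1) :=
    fun hf x => by rw [← hf.even]; ring_nf
  -- `e1` and `e2` now say that both sides are unchanged when `1` is replaced by `-1`.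
  simp only [refl_sub hv, refl_sub hw, refl_add hw] at e1 e2
  have hpos : 0 ≤ ∑ᶠ x, u x * ((v (x - 1) - v (x + 1)) * (w (x - 1) - w (x + 1))) :=
    finsum_nonneg fun x => mul_nonneg (hu.nonneg x) (hv.diff_mul_diff_nonneg hw x)
  have hsum : ∑ᶠ x, u x * ((v (x - 1) - v (x + 1)) * (w (x - 1) - w (x + 1))) =
      (∑ᶠ x, u x * (v (x - 1) * w (x - 1)) + ∑ᶠ x, u x * (v (x + 1) * w (x + 1))) -
      (∑ᶠ x, u x * (v (x - 1) * w (x + 1)) + ∑ᶠ x, u x * (v (x + 1) * w (x - 1))) := by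
    rw [← finsum_add_distrib (fin _) (fin _), ← finsum_add_distrib (fin _) (fin _),
      ← finsum_sub_distrib]
    · exact finsum_congr fun x => by ring
    · simp only [← mul_add]; exact fin _
    · simp only [← mul_add]; exact fin _
  omega

/-- Twice the difference of the two sides is the sum of
`(u (x - 1) - u (x + 1)) * (v (x - 1) - v (x + 1))`. -/
lemma finsum_mul_shift_two_le (hu : IsSymmUnimodal u) (hv : IsSymmUnimodal v) :
    ∑ᶠ x, u x * v (x - 2) ≤ ∑ᶠ x, u x * v x := by
  have finu : ∀ (e : ℤ ≃ ℤ) (g : ℤ → ℤ), (fun x => u (e x) * g x).support.Finite := fun e g =>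
    (hu.finite_support_comp e).subset fun x hx h => hx (by simp_all)
  have fin_sub := finu (Equiv.subRight 1)
  have fin_add := finu (Equiv.addRight 1)
  simp only [Equiv.subRight_apply, Equiv.coe_addRight] at fin_sub fin_add
  have e1 : ∑ᶠ x, u (x - 1) * v (x - 1) = ∑ᶠ x, u x * v x :=
    finsum_comp_equiv (Equiv.subRight (1 : ℤ)) (f := fun x => u x * v x)
  have e2 : ∑ᶠ x, u (x + 1) * v (x + 1) = ∑ᶠ x, u x * v x :=
    finsum_comp_equiv (Equiv.addRight (1 : ℤ)) (f := fun x => u x * v x)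
  have e3 : ∑ᶠ x, u (x + 1) * v (x - 1) = ∑ᶠ x, u x * v (x - 2) := by
    rw [← finsum_comp_equiv (Equiv.addRight (1 : ℤ)) (f := fun x => u x * v (x - 2))]
    refine finsum_congr fun x => ?_
    rw [Equiv.coe_addRight, show x + 1 - 2 = x - 1 by ring]
  have e4 : ∑ᶠ x, u (x - 1) * v (x + 1) = ∑ᶠ x, u x * v (x - 2) := by
    rw [← e3, ← finsum_comp_equiv (Equiv.neg ℤ)]
    refine finsum_congr fun x => ?_
    rw [Equiv.neg_apply, ← hu.even, ← hv.even (-x + 1)]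
    ring_nf
  have hpos : 0 ≤ ∑ᶠ x, (u (x - 1) - u (x + 1)) * (v (x - 1) - v (x + 1)) :=
    finsum_nonneg fun x => hu.diff_mul_diff_nonneg hv x
  have hsum : ∑ᶠ x, (u (x - 1) - u (x + 1)) * (v (x - 1) - v (x + 1)) =
      (∑ᶠ x, u (x - 1) * v (x - 1) + ∑ᶠ x, u (x + 1) * v (x + 1)) -
      (∑ᶠ x, u (x - 1) * v (x + 1) + ∑ᶠ x, u (x + 1) * v (x - 1)) := by
    rw [← finsum_add_distrib (fin_sub _) (fin_add _),
      ← finsum_add_distrib (fin_sub _) (fin_add _), ← finsum_sub_distrib]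
    · exact finsum_congr fun x => by ring
    · exact ((fin_sub _).union (fin_add _)).subset (Function.support_add _ _)
    · exact ((fin_sub _).union (fin_add _)).subset (Function.support_add _ _)
  omega

end IsSymmUnimodal

/-! ### Flows on the triangle -/

/-- The total weight of the integral flows on a triangle with vertices `0, 1, 2` whose net inflow is
`a` at vertex `0` and `b` at vertex `1` (hence `-a - b` at vertex `2`). A flow `x` from `1` to `0`
has weight `u x`, a flow `y` from `2` to `0` has weight `v y`, and a flow `z` from `2` to `1` has
weight `w z`. -/
noncomputable def flow (u v w : ℤ → ℤ) (a b : ℤ) : ℤ := ∑ᶠ x, u x * (v (a - x) * w (b + x))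

section flow

variable {u v w : ℤ → ℤ}

lemma flow_step_left (hu : IsSymmUnimodal u) (v w : ℤ → ℤ) (a b : ℤ) :
    flow (fun x => u (x - 1) + u (x + 1)) v w a b =
      flow u v w (a - 1) (b + 1) + flow u v w (a + 1) (b - 1) := by
  have fin : ∀ (e : ℤ ≃ ℤ) (g : ℤ → ℤ), (fun x => u (e x) * g x).support.Finite := fun e g =>
    (hu.finite_support_comp e).subset fun x hx h => hx (by simp_all)
  have fin_sub := fin (Equiv.subRight 1)
  have fin_add := fin (Equiv.addRight 1)
  simp only [Equiv.subRight_apply, Equiv.coe_addRight] at fin_sub fin_add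
  unfold flow
  simp only [add_mul]
  rw [finsum_add_distrib (fin_sub _) (fin_add _)]
  congr 1
  · rw [← finsum_comp_equiv (Equiv.subRight (1 : ℤ)) (f := fun x => u x * _)]
    refine finsum_congr fun x => ?_
    rw [Equiv.subRight_apply, show a - 1 - (x - 1) = a - x by ring,
      show b + 1 + (x - 1) = b + x by ring]
  · rw [← finsum_comp_equiv (Equiv.addRight (1 : ℤ)) (f := fun x => u x * _)]
    refine finsum_congr fun x => ?_
    rw [Equiv.coe_addRight, show a + 1 - (x + 1) = a - x by ring,
      show b - 1 + (x + 1) = b + x by ring]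

lemma flow_step_middle (hu : IsSymmUnimodal u) (v w : ℤ → ℤ) (a b : ℤ) :
    flow u (fun x => v (x - 1) + v (x + 1)) w a b =
      flow u v w (a - 1) b + flow u v w (a + 1) b := by
  have fin : ∀ g : ℤ → ℤ, (fun x => u x * g x).support.Finite := fun g =>
    hu.finite_support.subset fun x hx h => hx (by simp [h])
  unfold flow
  rw [← finsum_add_distrib (fin _) (fin _)]
  refine finsum_congr fun x => ?_
  rw [show a - 1 - x = a - x - 1 by ring, show a + 1 - x = a - x + 1 by ring]
  ring

lemma flow_step_right (hu : IsSymmUnimodal u) (v w : ℤ → ℤ) (a b : ℤ) :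
    flow u v (fun x => w (x - 1) + w (x + 1)) a b =
      flow u v w a (b - 1) + flow u v w a (b + 1) := by
  have fin : ∀ g : ℤ → ℤ, (fun x => u x * g x).support.Finite := fun g =>
    hu.finite_support.subset fun x hx h => hx (by simp [h])
  unfold flow
  rw [← finsum_add_distrib (fin _) (fin _)]
  refine finsum_congr fun x => ?_
  rw [show b - 1 + x = b + x - 1 by ring, show b + 1 + x = b + x + 1 by ring]
  ring

variable (hu : IsSymmUnimodal u) (hv : IsSymmUnimodal v) (hw : IsSymmUnimodal w)
include hu hv hw

/-- The inequality behind the sign of the cofactor `(2, 2)`. -/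
lemma flow_two_neg_two_le : flow u v w 2 (-2) ≤ flow u v w 0 0 := by
  convert hu.finsum_mul_shift_two_le (hv.mul hw) using 1
  · refine finsum_congr fun x => ?_
    rw [← hv.even]
    ring_nf
  · refine finsum_congr fun x => ?_
    rw [← hv.even]
    ring_nf

/-- The inequality behind the sign of the cofactor `(1, 1)`. -/
lemma flow_two_zero_le : flow u v w 2 0 ≤ flow u v w 0 0 := by
  convert (hu.mul hw).finsum_mul_shift_two_le hv using 1
  · refine finsum_congr fun x => ?_
    rw [← hv.even]
    ring_nf
  · refine finsum_congr fun x => ?_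
    rw [← hv.even]
    ring_nf

/-- The inequality behind the sign of the cofactor `(0, 0)`. -/
lemma flow_zero_neg_two_le : flow u v w 0 (-2) ≤ flow u v w 0 0 := by
  convert (hu.mul hv).finsum_mul_shift_two_le hw using 1
  · refine finsum_congr fun x => ?_
    rw [← hv.even]
    ring_nf
  · refine finsum_congr fun x => ?_
    rw [← hv.even]
    ring_nf

/-- The inequality behind the sign of the cofactor `(0, 1)`. -/
lemma flow_one_one_le : flow u v w 1 1 ≤ flow u v w 1 (-1) := by
  convert hu.finsum_mul_shift_le hv hw using 1
  · refine finsum_congr fun x => ?_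
    rw [← hv.even]
    ring_nf
  · refine finsum_congr fun x => ?_
    rw [← hv.even]
    ring_nf

/-- The inequality behind the sign of the cofactor `(0, 2)`. -/
lemma flow_neg_one_two_le : flow u v w (-1) 2 ≤ flow u v w (-1) 0 := by
  convert hv.finsum_mul_shift_le hu hw using 1
  · rw [flow, ← finsum_comp_equiv (Equiv.subRight (1 : ℤ))]
    refine finsum_congr fun x => ?_
    rw [Equiv.subRight_apply, ← hv.even]
    ring_nf
  · rw [flow, ← finsum_comp_equiv (Equiv.subRight (1 : ℤ))]
    refine finsum_congr fun x => ?_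
    rw [Equiv.subRight_apply, ← hv.even]
    ring_nf

/-- The inequality behind the sign of the cofactor `(1, 2)`. -/
lemma flow_two_neg_one_le : flow u v w 2 (-1) ≤ flow u v w 0 1 := by
  convert hw.finsum_mul_shift_le hv hu using 1
  · rw [flow, ← finsum_comp_equiv (Equiv.addRight (1 : ℤ))]
    refine finsum_congr fun x => ?_
    rw [Equiv.coe_addRight, ← hv.even]
    ring_nf
  · rw [flow, ← finsum_comp_equiv (Equiv.subRight (1 : ℤ))]
    refine finsum_congr fun x => ?_
    rw [Equiv.subRight_apply, ← hv.even]
    ring_nf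

end flow

/-! ### Polynomials with nonnegative coefficients -/

section NonnegCoeff

variable {σ : Type*}

/-- All coefficients of the integral polynomial `p` are nonnegative. -/
def NonnegCoeff (p : MvPolynomial σ ℤ) : Prop := ∀ n, 0 ≤ coeff n p

lemma NonnegCoeff.zero : NonnegCoeff (0 : MvPolynomial σ ℤ) := fun n => by simp

lemma NonnegCoeff.add {p q : MvPolynomial σ ℤ} (hp : NonnegCoeff p) (hq : NonnegCoeff q) :
    NonnegCoeff (p + q) := fun n => by
  rw [coeff_add]
  exact add_nonneg (hp n) (hq n)

lemma NonnegCoeff.mul {p q : MvPolynomial σ ℤ} (hp : NonnegCoeff p) (hq : NonnegCoeff q) :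
    NonnegCoeff (p * q) := fun n => by
  classical
  rw [coeff_mul]
  exact Finset.sum_nonneg fun x _ => mul_nonneg (hp _) (hq _)

lemma NonnegCoeff.C {z : ℤ} (hz : 0 ≤ z) : NonnegCoeff (C z : MvPolynomial σ ℤ) := fun n => by
  classical
  rw [coeff_C]
  split_ifs <;> simp [hz]

lemma NonnegCoeff.X (i : σ) : NonnegCoeff (X i : MvPolynomial σ ℤ) := fun n => by
  classical
  rw [coeff_X]
  split_ifs <;> simp

end NonnegCoeff

/-! ### Coefficients of products of ternary linear forms -/

section lcoeff

variable {R : Type*} [CommRing R]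

/-- The coefficient of `H ^ z` in a polynomial in `H_0, H_1, H_2`, for an exponent `z` with integer
entries: it is `0` as soon as one entry is negative. -/
noncomputable def lcoeff (Q : MvPolynomial (Fin 3) R) (z : Fin 3 → ℤ) : R :=
  if ∀ i, 0 ≤ z i then coeff (Finsupp.equivFunOnFinite.symm fun i => (z i).toNat) Q else 0

/-- The linear form `y_0 H_0 + y_1 H_1 + y_2 H_2`. -/
noncomputable def linForm (y : Fin 3 → R) : MvPolynomial (Fin 3) R := ∑ i, C (y i) * X i

lemma lcoeff_natCast (Q : MvPolynomial (Fin 3) R) (d : Fin 3 → ℕ) :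
    lcoeff Q (fun i => (d i : ℤ)) = coeff (Finsupp.equivFunOnFinite.symm d) Q := by
  simp [lcoeff]

lemma lcoeff_one (z : Fin 3 → ℤ) :
    lcoeff (1 : MvPolynomial (Fin 3) R) z = if z = 0 then 1 else 0 := by
  unfold lcoeff
  by_cases hz : z = 0
  · subst hz
    rw [if_pos (by simp), if_pos rfl]
    convert coeff_zero_one
    ext i
    simp
  · rw [if_neg hz]
    split_ifs with h
    · rw [coeff_one, if_neg]
      intro h0
      refine hz (funext fun i => ?_)
      have := DFunLike.congr_fun h0 i
      have hi := h i
      simp only [Finsupp.equivFunOnFinite_symm_apply_apply, Finsupp.coe_zero, Pi.zero_apply]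
        at this ⊢
      omega
    · rfl

lemma lcoeff_X_mul (i : Fin 3) (Q : MvPolynomial (Fin 3) R) (z : Fin 3 → ℤ) :
    lcoeff (X i * Q) z = lcoeff Q (z - Pi.single i 1) := by
  unfold lcoeff
  by_cases hz : ∀ k, 0 ≤ z k
  · rw [if_pos hz, coeff_X_mul']
    have hmem : i ∈ (Finsupp.equivFunOnFinite.symm fun k => (z k).toNat).support ↔ 1 ≤ z i := by
      simp only [Finsupp.mem_support_iff, Finsupp.equivFunOnFinite_symm_apply_apply]
      have := hz i
      omega
    by_cases hi : 1 ≤ z i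
    · rw [if_pos (hmem.2 hi), if_pos]
      · congr 1
        ext k
        by_cases hk : k = i
        · subst hk
          simp
        · simp [hk]
      · intro k
        by_cases hk : k = i
        · subst hk
          simpa using hi
        · simpa [hk] using hz k
    · rw [if_neg (fun h => hi (hmem.1 h)), if_neg]
      intro h
      have := h i
      simp at this
      omega
  · rw [if_neg hz, if_neg]
    intro h
    refine hz fun k => ?_
    have := h k
    by_cases hk : k = i
    · subst hk
      simp at this
      omega
    · simpa [hk] using this

lemma lcoeff_add (P Q : MvPolynomial (Fin 3) R) (z : Fin 3 → ℤ) :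
    lcoeff (P + Q) z = lcoeff P z + lcoeff Q z := by
  unfold lcoeff
  split_ifs <;> simp

lemma lcoeff_C_mul (a : R) (Q : MvPolynomial (Fin 3) R) (z : Fin 3 → ℤ) :
    lcoeff (C a * Q) z = a * lcoeff Q z := by
  unfold lcoeff
  split_ifs <;> simp

lemma lcoeff_linForm_mul (y : Fin 3 → R) (Q : MvPolynomial (Fin 3) R) (z : Fin 3 → ℤ) :
    lcoeff (linForm y * Q) z = ∑ i, y i * lcoeff Q (z - Pi.single i 1) := by
  simp only [linForm, Fin.sum_univ_three, add_mul, mul_assoc, lcoeff_add, lcoeff_C_mul,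
    lcoeff_X_mul]

end lcoeff

/-! ### The cone of products of two coefficients -/

section Cone

variable {σ : Type*}

open Classical in
/-- The function of a pair of exponents `(m, m')` that is supported on the pairs with sum `s` and
equal total degrees, where it is `p` times the flow number with net inflow `m - m'`. -/
noncomputable def flowGenerator (p : MvPolynomial σ ℤ) (s : Fin 3 → ℤ) (u v w : ℤ → ℤ)
    (m m' : Fin 3 → ℤ) : MvPolynomial σ ℤ :=
  if m + m' = s ∧ ∑ i, m i = ∑ i, m' i then
    p * C (flow u v w (m 0 - m' 0) (m 1 - m' 1))
  else 0

/-- The additive monoid spanned by the functions `flowGenerator p s u v w` with `p` having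
nonnegative coefficients and `u, v, w` symmetric unimodal. -/
noncomputable def flowCone (σ : Type*) :
    AddSubmonoid ((Fin 3 → ℤ) → (Fin 3 → ℤ) → MvPolynomial σ ℤ) :=
  AddSubmonoid.closure {f | ∃ p s u v w, NonnegCoeff p ∧ IsSymmUnimodal u ∧ IsSymmUnimodal v ∧
    IsSymmUnimodal w ∧ f = flowGenerator p s u v w}

variable {f : (Fin 3 → ℤ) → (Fin 3 → ℤ) → MvPolynomial σ ℤ}

/-- A loop at the vertex `i` only translates the sum of the two exponents. -/
lemma loop_mem_flowCone (hf : f ∈ flowCone σ) {q : MvPolynomial σ ℤ} (hq : NonnegCoeff q)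
    (i : Fin 3) :
    (fun m m' => q * f (m - Pi.single i 1) (m' - Pi.single i 1)) ∈ flowCone σ := by
  induction hf using AddSubmonoid.closure_induction with
  | mem f hf =>
    obtain ⟨p, s, u, v, w, hp, hu, hv, hw, rfl⟩ := hf
    refine AddSubmonoid.subset_closure ⟨q * p, s + Pi.single i 1 + Pi.single i 1, u, v, w,
      hq.mul hp, hu, hv, hw, ?_⟩
    funext m m'
    have hc : (m - Pi.single i 1 + (m' - Pi.single i 1) = s ∧
        ∑ k, (m - Pi.single i 1 : Fin 3 → ℤ) k = ∑ k, (m' - Pi.single i 1 : Fin 3 → ℤ) k) ↔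
        (m + m' = s + Pi.single i 1 + Pi.single i 1 ∧ ∑ k, m k = ∑ k, m' k) := by
      refine and_congr ⟨fun h => ?_, fun h => ?_⟩ ?_
      · rw [← h]; abel
      · rw [sub_add_sub_comm, h]; abel
      · simp [Finset.sum_sub_distrib]
    simp only [flowGenerator, hc]
    simp only [mul_ite, mul_zero, Pi.sub_apply, sub_sub_sub_cancel_right, mul_assoc]
  | zero =>
    convert (flowCone σ).zero_mem using 1
    funext m m'
    simp
  | add f g _ _ hf hg =>
    convert (flowCone σ).add_mem hf hg using 1
    funext m m'
    exact mul_add _ _ _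

/-- An edge between the vertices `i` and `j` amounts to an application of `IsSymmUnimodal.step` to
the weight of that edge. -/
lemma edge_mem_flowCone (hf : f ∈ flowCone σ) {q : MvPolynomial σ ℤ} (hq : NonnegCoeff q)
    {i j : Fin 3} (hij : i < j) :
    (fun m m' => q * (f (m - Pi.single i 1) (m' - Pi.single j 1) +
      f (m - Pi.single j 1) (m' - Pi.single i 1))) ∈ flowCone σ := by
  induction hf using AddSubmonoid.closure_induction with
  | mem f hf =>
    obtain ⟨p, s, u, v, w, hp, hu, hv, hw, rfl⟩ := hf
    have hc : ∀ (i j : Fin 3) (m m' : Fin 3 → ℤ), (m - Pi.single i 1 + (m' - Pi.single j 1) = s ∧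
        ∑ k, (m - Pi.single i 1 : Fin 3 → ℤ) k = ∑ k, (m' - Pi.single j 1 : Fin 3 → ℤ) k) ↔
        (m + m' = s + (Pi.single i 1 + Pi.single j 1) ∧ ∑ k, m k = ∑ k, m' k) := by
      intro i j m m'
      refine and_congr ⟨fun h => ?_, fun h => ?_⟩ ?_
      · rw [← h]; abel
      · rw [sub_add_sub_comm, h]; abel
      · simp [Finset.sum_sub_distrib]
    let e : Fin 3 → Fin 3 → ℤ := fun k => Pi.single k 1
    obtain ⟨u', v', w', hu', hv', hw', hflow⟩ : ∃ u' v' w', IsSymmUnimodal u' ∧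
        IsSymmUnimodal v' ∧ IsSymmUnimodal w' ∧ ∀ m m' : Fin 3 → ℤ,
        flow u' v' w' (m 0 - m' 0) (m 1 - m' 1) =
          flow u v w (m 0 - e i 0 - (m' 0 - e j 0)) (m 1 - e i 1 - (m' 1 - e j 1)) +
          flow u v w (m 0 - e j 0 - (m' 0 - e i 0)) (m 1 - e j 1 - (m' 1 - e i 1)) := by
      have hcases : (i = 0 ∧ j = 1) ∨ (i = 0 ∧ j = 2) ∨ (i = 1 ∧ j = 2) := by
        revert i j; decide
      rcases hcases with ⟨rfl, rfl⟩ | ⟨rfl, rfl⟩ | ⟨rfl, rfl⟩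
      · refine ⟨_, v, w, hu.step, hv, hw, fun m m' => ?_⟩
        rw [flow_step_left hu]
        simp [e]
        ring_nf
      · refine ⟨u, _, w, hu, hv.step, hw, fun m m' => ?_⟩
        rw [flow_step_middle hu]
        simp [e]
        ring_nf
      · refine ⟨u, v, _, hu, hv, hw.step, fun m m' => ?_⟩
        rw [flow_step_right hu]
        simp [e]
        ring_nf
    refine AddSubmonoid.subset_closure ⟨q * p, s + (Pi.single i 1 + Pi.single j 1), u', v', w',
      hq.mul hp, hu', hv', hw', ?_⟩
    funext m m'
    have hc' := hc j i m m'
    rw [add_comm (Pi.single j 1)] at hc'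
    simp only [flowGenerator, hc i j m m', hc', hflow]
    simp only [e, Pi.sub_apply]
    split_ifs
    · rw [C_add]; ring
    · simp
  | zero =>
    convert (flowCone σ).zero_mem using 1
    funext m m'
    simp
  | add f g _ _ hf hg =>
    convert (flowCone σ).add_mem hf hg using 1
    funext m m'
    simp only [Pi.add_apply]
    ring

/-- The graph without edges: with all three weights concentrated at the origin, the only flow is
the zero flow. -/
lemma lcoeff_one_mem_flowCone :
    (fun m m' => lcoeff 1 m * lcoeff 1 m') ∈ flowCone σ := by
  refine AddSubmonoid.subset_closure ⟨1, 0, _, _, _, NonnegCoeff.C zero_le_one,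
    .indicator_zero, .indicator_zero, .indicator_zero, ?_⟩
  funext m m'
  have hflow : ∀ a b : ℤ, flow (fun x => if x = 0 then 1 else 0) (fun x => if x = 0 then 1 else 0)
      (fun x => if x = 0 then 1 else 0) a b = if a = 0 ∧ b = 0 then 1 else 0 := by
    intro a b
    rw [flow, finsum_eq_single _ 0 (fun x hx => by simp [hx])]
    by_cases ha : a = 0 <;> simp [ha]
  simp only [flowGenerator, hflow, lcoeff_one]
  -- `m - m'` vanishes at `0` and `1`, hence at `2` because its entries add up to zero.
  have hiff : (m = 0 ∧ m' = 0) ↔ ((m + m' = 0 ∧ ∑ i, m i = ∑ i, m' i) ∧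
      m 0 - m' 0 = 0 ∧ m 1 - m' 1 = 0) := by
    simp only [_root_.funext_iff, Fin.forall_fin_succ, Fin.sum_univ_three]
    simp
    omega
  by_cases h : m = 0 ∧ m' = 0
  · rw [if_pos h.1, if_pos h.2, if_pos (hiff.1 h).1, if_pos (hiff.1 h).2]
    simp
  · have h' := mt hiff.2 h
    by_cases h1 : m + m' = 0 ∧ ∑ i, m i = ∑ i, m' i
    · rw [if_pos h1, if_neg fun h2 => h' ⟨h1, h2⟩]
      by_cases h3 : m = 0
      · rw [if_neg fun h4 => h ⟨h3, h4⟩]; simp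
      · rw [if_neg h3]; simp
    · rw [if_neg h1]
      by_cases h3 : m = 0
      · rw [if_neg fun h4 => h ⟨h3, h4⟩]; simp
      · rw [if_neg h3]; simp

/-- Multiplying `Q` by a linear form turns the product of two coefficients into a combination of
three loop terms and three edge terms. -/
lemma linForm_mul_mem_flowCone {Q : MvPolynomial (Fin 3) (MvPolynomial σ ℤ)}
    (hQ : (fun m m' => lcoeff Q m * lcoeff Q m') ∈ flowCone σ)
    {y : Fin 3 → MvPolynomial σ ℤ} (hy : ∀ i, NonnegCoeff (y i)) :
    (fun m m' => lcoeff (linForm y * Q) m * lcoeff (linForm y * Q) m') ∈ flowCone σ := by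
  have hl := fun i => loop_mem_flowCone hQ ((hy i).mul (hy i)) i
  have he := fun i j (hij : i < j) => edge_mem_flowCone hQ ((hy i).mul (hy j)) hij
  convert add_mem (add_mem (add_mem (hl 0) (hl 1)) (hl 2))
    (add_mem (add_mem (he 0 1 (by decide)) (he 0 2 (by decide))) (he 1 2 (by decide))) using 1
  funext m m'
  simp only [lcoeff_linForm_mul, Fin.sum_univ_three, Pi.add_apply]
  ring

lemma prod_linForm_mem_flowCone {ι : Type*} (s : Finset ι) {y : ι → Fin 3 → MvPolynomial σ ℤ}
    (hy : ∀ j i, NonnegCoeff (y j i)) :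
    (fun m m' => lcoeff (∏ j ∈ s, linForm (y j)) m * lcoeff (∏ j ∈ s, linForm (y j)) m') ∈
      flowCone σ := by
  classical
  induction s using Finset.induction_on with
  | empty => simpa using lcoeff_one_mem_flowCone
  | insert j s hj ih =>
    simp only [Finset.prod_insert hj]
    exact linForm_mul_mem_flowCone ih (hy j)

/-- An inequality between flow numbers at two net inflows passes to every element of the cone,
coefficient by coefficient, for pairs of exponents with a common sum. -/
lemma nonnegCoeff_sub_of_mem_flowCone (hf : f ∈ flowCone σ) {m m' n n' : Fin 3 → ℤ}
    (hsum : m + m' = n + n') (hm : ∑ i, m i = ∑ i, m' i) (hn : ∑ i, n i = ∑ i, n' i)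
    (hflow : ∀ {u v w : ℤ → ℤ}, IsSymmUnimodal u → IsSymmUnimodal v → IsSymmUnimodal w →
      flow u v w (n 0 - n' 0) (n 1 - n' 1) ≤ flow u v w (m 0 - m' 0) (m 1 - m' 1)) :
    NonnegCoeff (f m m' - f n n') := by
  induction hf using AddSubmonoid.closure_induction with
  | mem f hf =>
    obtain ⟨p, s, u, v, w, hp, hu, hv, hw, rfl⟩ := hf
    simp only [flowGenerator, hsum, hm, hn, and_true]
    split_ifs
    · rw [← mul_sub, ← C_sub]
      exact hp.mul (.C (sub_nonneg.2 (hflow hu hv hw)))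
    · simpa using NonnegCoeff.zero
  | zero => simpa using NonnegCoeff.zero
  | add f g _ _ hf hg =>
    have := hf.add hg
    rwa [sub_add_sub_comm] at this

end Cone

/-! ### The Hessian of the cubic -/

/-- The product of the linear forms other than the cubed one. -/
noncomputable def formProd (r : ℕ) : MvPolynomial (Fin 3) (CoeffRing r) :=
  ∏ j : Fin r, linForm fun i => X (Sum.inr (i, j))

/-- The linear form `x_1 H_1 + x_2 H_2 + x_3 H_3`. -/
noncomputable def xForm (r : ℕ) : MvPolynomial (Fin 3) (CoeffRing r) :=
  linForm fun i => X (Sum.inl i)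

/-- The product of the other linear forms does not involve the variables `x_i`. -/
lemma pderiv_lcoeff_formProd (r : ℕ) (p : Fin 3) (z : Fin 3 → ℤ) :
    pderiv (Sum.inl p) (lcoeff (formProd r) z) = 0 := by
  unfold formProd
  generalize (Finset.univ : Finset (Fin r)) = s
  induction s using Finset.induction_on generalizing z with
  | empty =>
    rw [Finset.prod_empty, lcoeff_one]
    split_ifs <;> simp
  | insert j s hj ih =>
    rw [Finset.prod_insert hj, lcoeff_linForm_mul]
    simp [ih, Derivation.leibniz]

/-- The coefficientwise form of `∂(x · H) ^ (n + 1) / ∂x_p = (n + 1) (x · H) ^ n H_p`. -/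
lemma pderiv_lcoeff_xForm_pow (r : ℕ) (p : Fin 3) (n : ℕ) (z : Fin 3 → ℤ) :
    pderiv (Sum.inl p) (lcoeff (xForm r ^ (n + 1) * formProd r) z) =
      (n + 1 : CoeffRing r) * lcoeff (xForm r ^ n * formProd r) (z - Pi.single p 1) := by
  have hX : ∀ i : Fin 3, pderiv (Sum.inl p) (X (Sum.inl i) : CoeffRing r) =
      if i = p then 1 else 0 := by
    intro i
    rw [pderiv_X]
    by_cases h : i = p
    · subst h; simp
    · rw [Pi.single_eq_of_ne (by simpa using h), if_neg h]
  induction n generalizing z with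
  | zero =>
    rw [zero_add, pow_one, xForm, lcoeff_linForm_mul, map_sum]
    simp [Derivation.leibniz, pderiv_lcoeff_formProd, hX]
  | succ n ih =>
    have hx : ∀ (Q : MvPolynomial (Fin 3) (CoeffRing r)) (z : Fin 3 → ℤ), lcoeff (xForm r * Q) z =
        ∑ i, X (Sum.inl i) * lcoeff Q (z - Pi.single i 1) := lcoeff_linForm_mul _
    have hcomm : ∀ i : Fin 3, z - Pi.single i 1 - Pi.single p 1 =
      z - Pi.single p 1 - Pi.single i 1 := fun i => sub_right_comm _ _ _
    have hrec := hx (xForm r ^ n * formProd r) (z - Pi.single p 1)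
    rw [← mul_assoc, ← pow_succ'] at hrec
    rw [pow_succ', mul_assoc, hx, map_sum]
    simp only [Derivation.leibniz, ih, hX, smul_eq_mul, Finset.sum_add_distrib, mul_ite, mul_one,
      mul_zero, Finset.sum_ite_eq', Finset.mem_univ, if_true, hcomm,
      mul_left_comm _ (n + 1 : CoeffRing r)]
    rw [← Finset.mul_sum, ← hrec]
    push_cast
    ring

lemma hessian_apply (r : ℕ) (d : Fin 3 → ℕ) (p q : Fin 3) :
    hessian r d p q = 6 * lcoeff (xForm r * formProd r)
      ((fun i => (d i : ℤ)) - Pi.single p 1 - Pi.single q 1) := by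
  have hcubic : cubic r d = lcoeff (xForm r ^ (2 + 1) * formProd r) (fun i => (d i : ℤ)) := by
    rw [lcoeff_natCast]; rfl
  rw [hessian, Matrix.of_apply, hcubic, pderiv_lcoeff_xForm_pow, Derivation.leibniz,
    show (2 : ℕ) = 1 + 1 from rfl, pderiv_lcoeff_xForm_pow, sub_right_comm]
  have : pderiv (Sum.inl p) (((1 + 1 : ℕ) : CoeffRing r) + 1) = 0 := by
    exact_mod_cast (pderiv (Sum.inl p)).map_natCast (1 + 1 + 1)
  rw [this]
  simp
  ring

lemma hessian_symm (r : ℕ) (d : Fin 3 → ℕ) (p q : Fin 3) : hessian r d p q = hessian r d q p := by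
  rw [hessian_apply, hessian_apply, sub_right_comm]

/-- Every `2 × 2` minor of the Hessian matrix is, up to sign, a difference of two products of coefficients to
which `nonnegCoeff_sub_of_mem_flowCone` applies. -/
lemma nonnegCoeff_hessian_sub (r : ℕ) (d : Fin 3 → ℕ) {p q p' q' k l k' l' : Fin 3}
    (hsum : (Pi.single p 1 + Pi.single q 1 + (Pi.single p' 1 + Pi.single q' 1) : Fin 3 → ℤ) =
      Pi.single k 1 + Pi.single l 1 + (Pi.single k' 1 + Pi.single l' 1))
    (hflow : ∀ {u v w : ℤ → ℤ}, IsSymmUnimodal u → IsSymmUnimodal v → IsSymmUnimodal w →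
      flow u v w ((Pi.single k' 1 + Pi.single l' 1 - Pi.single k 1 - Pi.single l 1 : Fin 3 → ℤ) 0)
        ((Pi.single k' 1 + Pi.single l' 1 - Pi.single k 1 - Pi.single l 1 : Fin 3 → ℤ) 1) ≤
      flow u v w ((Pi.single p' 1 + Pi.single q' 1 - Pi.single p 1 - Pi.single q 1 : Fin 3 → ℤ) 0)
        ((Pi.single p' 1 + Pi.single q' 1 - Pi.single p 1 - Pi.single q 1 : Fin 3 → ℤ) 1)) :
    NonnegCoeff (hessian r d p q * hessian r d p' q' - hessian r d k l * hessian r d k' l') := by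
  set D : Fin 3 → ℤ := fun i => (d i : ℤ) with hD
  have hmem : (fun m m' => lcoeff (xForm r * formProd r) m * lcoeff (xForm r * formProd r) m') ∈
      flowCone (Var r) :=
    linForm_mul_mem_flowCone (prod_linForm_mem_flowCone _ fun _ _ => .X _) fun _ => .X _
  have key := nonnegCoeff_sub_of_mem_flowCone hmem
    (m := D - Pi.single p 1 - Pi.single q 1) (m' := D - Pi.single p' 1 - Pi.single q' 1)
    (n := D - Pi.single k 1 - Pi.single l 1) (n' := D - Pi.single k' 1 - Pi.single l' 1)
    (by
      have h : ∀ a b a' b' : Fin 3 → ℤ,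
          D - a - b + (D - a' - b') = D + D - (a + b + (a' + b')) := fun _ _ _ _ => by abel
      rw [h, h, hsum])
    (by simp [Finset.sum_sub_distrib]) (by simp [Finset.sum_sub_distrib])
    (by
      intro u v w hu hv hw
      convert hflow hu hv hw using 2 <;> simp only [Pi.sub_apply, Pi.add_apply] <;> ring)
  -- `36` is the product of the factors `6` in two entries of the Hessian matrix.
  convert (NonnegCoeff.C (σ := Var r) (show (0 : ℤ) ≤ 36 by norm_num)).mul key using 1
  simp only [hessian_apply, ← hD]
  rw [show (C 36 : CoeffRing r) = 36 from rfl]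
  ring

end CubicCofactors

/-! ### Signs of the cofactors -/

open CubicCofactors in
theorem theorem3p1 (r : ℕ) (d : Fin 3 → ℕ) (hd : ∀ i, 0 < d i)
    (hdr : d 0 + d 1 + d 2 = r + 3) :
    (∀ p : Fin 3, ∀ m ∈ (CubicCofactors.cofactors r d p p).support,
      MvPolynomial.coeff m (CubicCofactors.cofactors r d p p) < 0) ∧
    (∀ p q : Fin 3, p ≠ q → ∀ m ∈ (CubicCofactors.cofactors r d p q).support,
      0 < MvPolynomial.coeff m (CubicCofactors.cofactors r d p q)) := by
  have hdiag : ∀ p, NonnegCoeff (-cofactors r d p p) := by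
    have h0 := nonnegCoeff_hessian_sub r d (p := 1) (q := 2) (p' := 1) (q' := 2)
      (k := 1) (l := 1) (k' := 2) (l' := 2) (by decide +revert)
      fun hu hv hw => by simpa using flow_zero_neg_two_le hu hv hw
    have h1 := nonnegCoeff_hessian_sub r d (p := 0) (q := 2) (p' := 0) (q' := 2)
      (k := 2) (l := 2) (k' := 0) (l' := 0) (by decide +revert)
      fun hu hv hw => by simpa using flow_two_zero_le hu hv hw
    have h2 := nonnegCoeff_hessian_sub r d (p := 0) (q := 1) (p' := 0) (q' := 1)
      (k := 1) (l := 1) (k' := 0) (l' := 0) (by decide +revert)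
      fun hu hv hw => by simpa using flow_two_neg_two_le hu hv hw
    intro p
    fin_cases p
    · convert h0 using 1
      simp [cofactors, Matrix.adjugate_fin_three, hessian_symm r d 2 1]
    · convert h1 using 1
      simp [cofactors, Matrix.adjugate_fin_three, hessian_symm r d 2 0]
      ring
    · convert h2 using 1
      simp [cofactors, Matrix.adjugate_fin_three, hessian_symm r d 1 0]
      ring
  have hoff : ∀ p q, p ≠ q → NonnegCoeff (cofactors r d p q) := by
    have h01 := nonnegCoeff_hessian_sub r d (p := 1) (q := 2) (p' := 0) (q' := 2)
      (k := 2) (l := 2) (k' := 0) (l' := 1) (by decide +revert)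
      fun hu hv hw => by simpa using flow_one_one_le hu hv hw
    have h02 := nonnegCoeff_hessian_sub r d (p := 0) (q := 1) (p' := 1) (q' := 2)
      (k := 0) (l := 2) (k' := 1) (l' := 1) (by decide +revert)
      fun hu hv hw => by simpa using flow_neg_one_two_le hu hv hw
    have h12 := nonnegCoeff_hessian_sub r d (p := 0) (q := 2) (p' := 0) (q' := 1)
      (k := 1) (l := 2) (k' := 0) (l' := 0) (by decide +revert)
      fun hu hv hw => by simpa using flow_two_neg_one_le hu hv hw
    have s10 := hessian_symm r d 1 0
    have s20 := hessian_symm r d 2 0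
    have s21 := hessian_symm r d 2 1
    intro p q hpq
    fin_cases p <;> fin_cases q <;> first | exact absurd rfl hpq | skip
    · convert h01 using 1
      simp [cofactors, Matrix.adjugate_fin_three, s10, s20, s21]; ring
    · convert h02 using 1
      simp [cofactors, Matrix.adjugate_fin_three, s10, s20, s21]
    · convert h01 using 1
      simp [cofactors, Matrix.adjugate_fin_three, s10, s20, s21]; ring
    · convert h12 using 1
      simp [cofactors, Matrix.adjugate_fin_three, s10, s20, s21]; ring
    · convert h02 using 1
      simp [cofactors, Matrix.adjugate_fin_three, s10, s20, s21]; ring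
    · convert h12 using 1
      simp [cofactors, Matrix.adjugate_fin_three, s10, s20, s21]; ring
  refine ⟨fun p m hm => ?_, fun p q hpq m hm => ?_⟩
  · have := hdiag p m
    rw [coeff_neg] at this
    have := mem_support_iff.1 hm
    omega
  · exact lt_of_le_of_ne (hoff p q hpq m) (mem_support_iff.1 hm).symm
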